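/- Throughout, "space" means Tychonoff (completely regular Hausdorff) space. A zero set of a space $X$ is a set of the form $f^{-1}(0)$ with $f\colon X\to\mathbb R$ continuous, and a cozero set is the complement of a zero set. A family $\mathcal N$ of subsets of $X$ is a network if every open subset of $X$ is the union of some subfamily of $\mathcal N$, and a $cz$-network if every cozero set of $X$ is the union of an at most countable subfamily of $\mathcal N$. Let $$w(X)=\min\{|\mathcal B|:\mathcal B\text{ is a base of }X\}+\omega,$$ $$nw(X)=\min\{|\mathcal N|:\mathcal N\text{ is a network of }X\}+\omega,$$ $$nw_{cz}(X)=\min\{|\mathcal N|:\mathcal N\text{ is a }cz\text{-network of }X\}+\omega.$$ A subset $X$ of a space $Y$ is $z$-embedded in $Y$ if every zero set of the subspace $X$ has the form $F\cap X$ for some zero set $F$ of $Y$. A Lindelöf $p$-space is a space that admits a perfect map (a continuous closed map with compact fibres) onto a space with a countable base; a Lindelöf $\Sigma$-space is a space that is a continuous image of a Lindelöf $p$-space. Theorem. Let $X$ be a space. Then: (1) $nw(X)\le nw_{cz}(X)\le 2^{nw(X)}$; (2) if $X$ is compact, then $nw_{cz}(X)=nw(X)=w(X)$; (3) if $Y$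 is a space and $X\subset Y$ is $z$-embedded in $Y$, then $nw_{cz}(X)\le nw_{cz}(Y)$; (4) if $Y$ is a space and $f\colon Y\to X$ is a continuous surjection, then $nw_{cz}(X)\le nw_{cz}(Y)$; (5) if $X$ is Lindelöf, then $nw_{cz}(X)\le w(X)$; (6) if $X$ is a Lindelöf $\Sigma$-space, then $nw_{cz}(X)=nw(X)$; (7) if $nw(X)=\omega$, then $nw_{cz}(X)=\omega$; (8) if $A$ is an infinite set, $X_\alpha$ ($\alpha\in A$) are separable metrizable spaces each having more than one point, and $X$ is a dense subspace of $\prod_{\alpha\in A}X_\alpha$, then $nw_{cz}(X)\le w(X)=|A|$. -/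

import Mathlib

open Set Topology Cardinal

universe u v w

namespace CzNet

/-- `F` is a zero set of `X`: the preimage of `0` under a continuous real-valued function. -/
def IsZeroSet {X : Type u} [TopologicalSpace X] (F : Set X) : Prop :=
  ∃ f : X → ℝ, Continuous f ∧ F = f ⁻¹' {0}

/-- A cozero set is the complement of a zero set. -/
def IsCozeroSet {X : Type u} [TopologicalSpace X] (U : Set X) : Prop :=
  IsZeroSet Uᶜ

/-- A subset `S` of `Y` is z-embedded if every zero set of the subspace `S` is the trace on `S`
of a zero set of `Y`. -/
def IsZEmbedded {Y : Type u} [TopologicalSpace Y] (S : Set Y) : Prop :=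
  ∀ Q : Set S, IsZeroSet Q → ∃ F : Set Y, IsZeroSet F ∧ Q = (Subtype.val : S → Y) ⁻¹' F

/-- A family of subsets is a network if every open set is a union of members of the family. -/
def IsNetwork {X : Type u} [TopologicalSpace X] (N : Set (Set X)) : Prop :=
  ∀ U : Set X, IsOpen U → ∃ M ⊆ N, ⋃₀ M = U

/-- A family of subsets is a cz-network if every cozero set is the union of an at most countable
subfamily. -/
def IsCzNetwork {X : Type u} [TopologicalSpace X] (N : Set (Set X)) : Prop :=
  ∀ U : Set X, IsCozeroSet U → ∃ M ⊆ N, M.Countable ∧ ⋃₀ M = U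

/-- The weight `w(X)`: the least cardinality of a base, plus `ω`. -/
noncomputable def weight (X : Type u) [TopologicalSpace X] : Cardinal.{u} :=
  sInf {κ | ∃ B : Set (Set X), TopologicalSpace.IsTopologicalBasis B ∧ #B = κ} + ℵ₀

/-- The network weight `nw(X)`: the least cardinality of a network, plus `ω`. -/
noncomputable def networkWeight (X : Type u) [TopologicalSpace X] : Cardinal.{u} :=
  sInf {κ | ∃ N : Set (Set X), IsNetwork N ∧ #N = κ} + ℵ₀

/-- The cz-network weight `nw_cz(X)`: the least cardinality of a cz-network, plus `ω`. -/
noncomputable def czNetworkWeight (X : Type u) [TopologicalSpace X] : Cardinal.{u} :=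
  sInf {κ | ∃ N : Set (Set X), IsCzNetwork N ∧ #N = κ} + ℵ₀

/-- A (Tychonoff) space `Y` is a Lindelöf p-space if there is a perfect map of `Y` onto a
(Tychonoff) space with a countable base. A proper map in the sense of Mathlib is the same as a
continuous closed map with compact fibres. -/
def IsLindelofPSpace (Y : Type u) [TopologicalSpace Y] : Prop :=
  T35Space Y ∧
    ∃ (M : Type u) (_ : TopologicalSpace M), T35Space M ∧ SecondCountableTopology M ∧
      ∃ g : Y → M, IsProperMap g ∧ Function.Surjective g

/-- A (Tychonoff) space is a Lindelöf Σ-space if it is a continuous image of a Lindelöf p-space.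
Taking `Y` in the universe of `X` is no restriction: if `f : Y → X` is a continuous surjection and
`g : Y → M` a perfect surjection, then the image of `Y` in `X × M` is again a Lindelöf p-space
that maps onto `X`, and `M` embeds in the Hilbert cube. -/
def IsLindelofSigmaSpace (X : Type u) [TopologicalSpace X] : Prop :=
  T35Space X ∧
    ∃ (Y : Type u) (_ : TopologicalSpace Y), IsLindelofPSpace Y ∧
      ∃ f : Y → X, Continuous f ∧ Function.Surjective f

end CzNet

/-! Cozero sets form a base of a Tychonoff space, so a cz-network is a network; conversely the
family of all open sets is a cz-network, and a network of size κ yields at most 2^κ open sets.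
Traces and images of cz-networks give monotonicity.

In a Lindelöf space cozero sets are Lindelöf, being F_σ, so every base is a cz-network. Statements
(2) and (6) combine this with `weight_le_networkWeight_of_isProperMap`: weight and network weight
agree for a Hausdorff space with a proper map to a second countable one. A Lindelöf Σ-space X is an
image of such a space inside X × M, whose network weight is at most that of X.

For dense subspaces of products, the standard boxes form a cz-network: the complement of the closure
of an open set is a union of boxes with coordinates in one countable set
(`exists_countable_forall_disjoint_box`), and a cozero set is a countable union of such complements.
-/

namespace CzNet

/-! ### Cozero sets, networks and the elementary inequalities -/

section Basic

variable {X : Type u} [TopologicalSpace X]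

theorem IsZeroSet.isClosed {F : Set X} (h : IsZeroSet F) : IsClosed F := by
  obtain ⟨f, hf, rfl⟩ := h
  exact isClosed_singleton.preimage hf

theorem IsZeroSet.preimage {Y : Type v} [TopologicalSpace Y] {F : Set Y} (h : IsZeroSet F)
    {g : X → Y} (hg : Continuous g) : IsZeroSet (g ⁻¹' F) := by
  obtain ⟨f, hf, rfl⟩ := h
  exact ⟨f ∘ g, hf.comp hg, rfl⟩

theorem IsCozeroSet.isOpen {U : Set X} (h : IsCozeroSet U) : IsOpen U :=
  isClosed_compl_iff.mp (IsZeroSet.isClosed h)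

theorem IsCozeroSet.preimage {Y : Type v} [TopologicalSpace Y] {U : Set Y} (h : IsCozeroSet U)
    {g : X → Y} (hg : Continuous g) : IsCozeroSet (g ⁻¹' U) :=
  IsZeroSet.preimage (F := Uᶜ) h hg

theorem IsCozeroSet.exists_continuous_nonneg {U : Set X} (h : IsCozeroSet U) :
    ∃ f : X → ℝ, Continuous f ∧ (∀ x, 0 ≤ f x) ∧ ∀ x, x ∈ U ↔ 0 < f x := by
  obtain ⟨f, hf, hU⟩ := h
  refine ⟨fun x => |f x|, hf.abs, fun x => abs_nonneg _, fun x => ?_⟩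
  have := Set.ext_iff.mp hU x
  simp only [mem_compl_iff, mem_preimage, mem_singleton_iff] at this
  rw [abs_pos, ne_eq, ← this, not_not]

theorem exists_isCozeroSet_subset [CompletelyRegularSpace X] {U : Set X} (hU : IsOpen U) {x : X}
    (hx : x ∈ U) : ∃ V, IsCozeroSet V ∧ x ∈ V ∧ V ⊆ U := by
  obtain ⟨f, hf, hfx, hfU⟩ :=
    CompletelyRegularSpace.completely_regular x Uᶜ hU.isClosed_compl (by simpa using hx)
  refine ⟨{y | 1 - (f y : ℝ) ≠ 0}, ⟨fun y => 1 - (f y : ℝ), by fun_prop, ?_⟩, ?_, ?_⟩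
  · ext y
    simp
  · simp [hfx]
  · intro y hy
    by_contra hyU
    exact hy (by simp [hfU hyU])

theorem IsCzNetwork.isNetwork [CompletelyRegularSpace X] {N : Set (Set X)} (h : IsCzNetwork N) :
    IsNetwork N := by
  intro U hU
  refine ⟨{s ∈ N | s ⊆ U}, fun s hs => hs.1, Subset.antisymm (sUnion_subset fun s hs => hs.2) ?_⟩
  intro x hx
  obtain ⟨V, hV, hxV, hVU⟩ := exists_isCozeroSet_subset hU hx
  obtain ⟨M, hMN, -, rfl⟩ := h V hV
  obtain ⟨s, hs, hxs⟩ := hxV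
  exact ⟨s, ⟨hMN hs, (subset_sUnion_of_mem hs).trans hVU⟩, hxs⟩

theorem _root_.TopologicalSpace.IsTopologicalBasis.isNetwork {B : Set (Set X)}
    (h : TopologicalSpace.IsTopologicalBasis B) : IsNetwork B := fun U hU => by
  obtain ⟨S, hS, rfl⟩ := h.open_eq_sUnion hU
  exact ⟨S, hS, rfl⟩

theorem IsNetwork.exists_mem_subset {N : Set (Set X)} (h : IsNetwork N) {U : Set X}
    (hU : IsOpen U) {x : X} (hx : x ∈ U) : ∃ s ∈ N, x ∈ s ∧ s ⊆ U := by
  obtain ⟨M, hM, rfl⟩ := h U hU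
  obtain ⟨s, hs, hxs⟩ := hx
  exact ⟨s, hM hs, hxs, subset_sUnion_of_mem hs⟩

theorem IsNetwork.isCzNetwork_of_countable {N : Set (Set X)} (h : IsNetwork N)
    (hN : N.Countable) : IsCzNetwork N := fun U hU => by
  obtain ⟨M, hM, rfl⟩ := h U hU.isOpen
  exact ⟨M, hM, hN.mono hM, rfl⟩

theorem isCzNetwork_setOf_isOpen : IsCzNetwork {U : Set X | IsOpen U} := fun U hU =>
  ⟨{U}, by simpa using hU.isOpen, countable_singleton U, sUnion_singleton U⟩

/-- Taking unions maps a set of subfamilies of N onto the open sets. -/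
theorem IsNetwork.mk_setOf_isOpen_le {N : Set (Set X)} (h : IsNetwork N) :
    #{U : Set X | IsOpen U} ≤ 2 ^ #N := by
  rw [← mk_set]
  refine mk_le_of_surjective (f := fun M : {M : Set N // IsOpen (⋃₀ (Subtype.val '' M))} =>
    (⟨⋃₀ (Subtype.val '' M.1), M.2⟩ : {U : Set X | IsOpen U})) ?_ |>.trans (mk_subtype_le _)
  rintro ⟨U, hU⟩
  obtain ⟨M, hM, rfl⟩ := h U hU
  have : Subtype.val '' (Subtype.val ⁻¹' M : Set N) = M := by
    rw [Subtype.image_preimage_coe]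
    exact inter_eq_right.mpr hM
  exact ⟨⟨Subtype.val ⁻¹' M, by rwa [this]⟩, by simp [this]⟩

theorem aleph0_le_weight : ℵ₀ ≤ weight X := self_le_add_left _ _

theorem aleph0_le_networkWeight : ℵ₀ ≤ networkWeight X := self_le_add_left _ _

theorem aleph0_le_czNetworkWeight : ℵ₀ ≤ czNetworkWeight X := self_le_add_left _ _

theorem weight_le {B : Set (Set X)} (h : TopologicalSpace.IsTopologicalBasis B) {κ : Cardinal.{u}}
    (hB : #B ≤ κ) (hκ : ℵ₀ ≤ κ) : weight X ≤ κ :=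
  add_le_of_le hκ ((csInf_le' (by exact ⟨B, h, rfl⟩)).trans hB) hκ

theorem networkWeight_le {N : Set (Set X)} (h : IsNetwork N) {κ : Cardinal.{u}}
    (hN : #N ≤ κ) (hκ : ℵ₀ ≤ κ) : networkWeight X ≤ κ :=
  add_le_of_le hκ ((csInf_le' (by exact ⟨N, h, rfl⟩)).trans hN) hκ

theorem czNetworkWeight_le {N : Set (Set X)} (h : IsCzNetwork N) {κ : Cardinal.{u}}
    (hN : #N ≤ κ) (hκ : ℵ₀ ≤ κ) : czNetworkWeight X ≤ κ :=
  add_le_of_le hκ ((csInf_le' (by exact ⟨N, h, rfl⟩)).trans hN) hκ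

variable (X)

theorem exists_isTopologicalBasis_mk_le_weight :
    ∃ B : Set (Set X), TopologicalSpace.IsTopologicalBasis B ∧ #B ≤ weight X := by
  obtain ⟨B, hB, h⟩ := csInf_mem
    (s := {κ | ∃ B : Set (Set X), TopologicalSpace.IsTopologicalBasis B ∧ #B = κ})
    ⟨_, _, TopologicalSpace.isTopologicalBasis_opens, rfl⟩
  exact ⟨B, hB, h.trans_le (self_le_add_right _ _)⟩

theorem exists_isNetwork_mk_le_networkWeight :
    ∃ N : Set (Set X), IsNetwork N ∧ #N ≤ networkWeight X := by
  obtain ⟨N, hN, h⟩ := csInf_mem (s := {κ | ∃ N : Set (Set X), IsNetwork N ∧ #N = κ})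
    ⟨_, _, TopologicalSpace.isTopologicalBasis_opens.isNetwork, rfl⟩
  exact ⟨N, hN, h.trans_le (self_le_add_right _ _)⟩

theorem exists_isCzNetwork_mk_le_czNetworkWeight :
    ∃ N : Set (Set X), IsCzNetwork N ∧ #N ≤ czNetworkWeight X := by
  obtain ⟨N, hN, h⟩ := csInf_mem (s := {κ | ∃ N : Set (Set X), IsCzNetwork N ∧ #N = κ})
    ⟨_, _, isCzNetwork_setOf_isOpen, rfl⟩
  exact ⟨N, hN, h.trans_le (self_le_add_right _ _)⟩

theorem networkWeight_le_czNetworkWeight [CompletelyRegularSpace X] :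
    networkWeight X ≤ czNetworkWeight X := by
  obtain ⟨N, hN, h⟩ := exists_isCzNetwork_mk_le_czNetworkWeight X
  exact networkWeight_le hN.isNetwork h aleph0_le_czNetworkWeight

theorem networkWeight_le_weight : networkWeight X ≤ weight X := by
  obtain ⟨B, hB, h⟩ := exists_isTopologicalBasis_mk_le_weight X
  exact networkWeight_le hB.isNetwork h aleph0_le_weight

theorem czNetworkWeight_le_two_power_networkWeight :
    czNetworkWeight X ≤ 2 ^ networkWeight X := by
  obtain ⟨N, hN, h⟩ := exists_isNetwork_mk_le_networkWeight X
  exact czNetworkWeight_le isCzNetwork_setOf_isOpen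
    (hN.mk_setOf_isOpen_le.trans (power_le_power_left two_ne_zero h))
    (aleph0_le_networkWeight.trans (cantor _).le)

theorem czNetworkWeight_eq_aleph0 (h : networkWeight X = ℵ₀) : czNetworkWeight X = ℵ₀ := by
  obtain ⟨N, hN, hle⟩ := exists_isNetwork_mk_le_networkWeight X
  rw [h] at hle
  exact (czNetworkWeight_le (hN.isCzNetwork_of_countable (le_aleph0_iff_set_countable.mp hle))
    hle le_rfl).antisymm aleph0_le_czNetworkWeight

variable {X}

/-- The set {f > 0} is the countable union of the closed sets {f ≥ 1/(n+1)}. -/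
theorem IsCozeroSet.isLindelof [LindelofSpace X] {U : Set X} (hU : IsCozeroSet U) :
    IsLindelof U := by
  obtain ⟨f, hf, -, hfU⟩ := hU.exists_continuous_nonneg
  have : U = ⋃ n : ℕ, {x | 1 / ((n : ℝ) + 1) ≤ f x} := by
    ext x
    simp only [hfU, mem_iUnion, mem_ofPred_eq]
    exact ⟨fun h => (exists_nat_one_div_lt h).imp fun _ => le_of_lt,
      fun ⟨n, hn⟩ => Nat.one_div_pos_of_nat.trans_le hn⟩
  rw [this]
  exact isLindelof_iUnion fun n => (isClosed_le continuous_const hf).isLindelof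

theorem _root_.TopologicalSpace.IsTopologicalBasis.isCzNetwork [LindelofSpace X] {B : Set (Set X)}
    (hB : TopologicalSpace.IsTopologicalBasis B) : IsCzNetwork B := by
  intro U hU
  obtain ⟨S, hS, hUS⟩ := hB.open_eq_sUnion hU.isOpen
  obtain ⟨t, htS, htc, ht⟩ := hU.isLindelof.elim_countable_subcover_image (b := S) (c := id)
    (fun s hs => hB.isOpen (hS hs)) (by rw [hUS, sUnion_eq_biUnion]; rfl)
  refine ⟨t, htS.trans hS, htc, Subset.antisymm ?_ ?_⟩
  · rw [hUS]
    exact sUnion_subset_sUnion htS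
  · rwa [sUnion_eq_biUnion]

theorem czNetworkWeight_le_weight [LindelofSpace X] : czNetworkWeight X ≤ weight X := by
  obtain ⟨B, hB, h⟩ := exists_isTopologicalBasis_mk_le_weight X
  exact czNetworkWeight_le hB.isCzNetwork h aleph0_le_weight

end Basic

/-! ### Embeddings and continuous images, across universes -/

section Transfer

theorem lift_add_aleph0_le {κ μ : Cardinal.{u}} {ν : Cardinal.{v}} (hκ : κ ≤ μ)
    (hμ : Cardinal.lift.{v} μ ≤ Cardinal.lift.{u} ν) (hν : ℵ₀ ≤ ν) :
    Cardinal.lift.{v} (κ + ℵ₀) ≤ Cardinal.lift.{u} ν := by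
  have h : ℵ₀ ≤ Cardinal.lift.{u} ν := by simpa using hν
  rw [lift_add, lift_aleph0]
  exact add_le_of_le h ((Cardinal.lift_le.mpr hκ).trans hμ) h

variable {X : Type u} {Y : Type v} [TopologicalSpace X] [TopologicalSpace Y]

theorem lift_weight_le {B : Set (Set X)} (h : TopologicalSpace.IsTopologicalBasis B)
    {κ : Cardinal.{v}} (hB : Cardinal.lift.{v} #B ≤ Cardinal.lift.{u} κ) (hκ : ℵ₀ ≤ κ) :
    Cardinal.lift.{v} (weight X) ≤ Cardinal.lift.{u} κ :=
  lift_add_aleph0_le (csInf_le' (by exact ⟨B, h, rfl⟩)) hB hκ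

theorem lift_czNetworkWeight_le {N : Set (Set X)} (h : IsCzNetwork N)
    {κ : Cardinal.{v}} (hN : Cardinal.lift.{v} #N ≤ Cardinal.lift.{u} κ) (hκ : ℵ₀ ≤ κ) :
    Cardinal.lift.{v} (czNetworkWeight X) ≤ Cardinal.lift.{u} κ :=
  lift_add_aleph0_le (csInf_le' (by exact ⟨N, h, rfl⟩)) hN hκ

theorem lift_czNetworkWeight_le_of_isZEmbedded {e : X → Y} (he : IsEmbedding e)
    (hz : IsZEmbedded (range e)) :
    Cardinal.lift.{v} (czNetworkWeight X) ≤ Cardinal.lift.{u} (czNetworkWeight Y) := by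
  obtain ⟨N, hN, h⟩ := exists_isCzNetwork_mk_le_czNetworkWeight Y
  refine lift_czNetworkWeight_le (N := (e ⁻¹' ·) '' N) (fun U hU => ?_)
    (mk_image_le_lift.trans (Cardinal.lift_le.mpr h)) aleph0_le_czNetworkWeight
  obtain ⟨F, hF, hQF⟩ := hz _
    (IsZeroSet.preimage (F := Uᶜ) hU he.toHomeomorph.symm.continuous)
  obtain ⟨M, hMN, hMc, hM⟩ := hN Fᶜ (by rwa [IsCozeroSet, compl_compl])
  refine ⟨(e ⁻¹' ·) '' M, image_mono hMN, hMc.image _, ?_⟩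
  rw [sUnion_image, ← preimage_iUnion₂, ← sUnion_eq_biUnion, hM]
  have hUF : Uᶜ = e ⁻¹' F := by
    ext x
    simpa using Set.ext_iff.mp hQF (he.toHomeomorph x)
  rw [preimage_compl, ← hUF, compl_compl]

theorem lift_czNetworkWeight_le_of_surjective {f : Y → X} (hf : Continuous f)
    (hs : Function.Surjective f) :
    Cardinal.lift.{v} (czNetworkWeight X) ≤ Cardinal.lift.{u} (czNetworkWeight Y) := by
  obtain ⟨N, hN, h⟩ := exists_isCzNetwork_mk_le_czNetworkWeight Y
  refine lift_czNetworkWeight_le (N := (f '' ·) '' N) (fun U hU => ?_)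
    (mk_image_le_lift.trans (Cardinal.lift_le.mpr h)) aleph0_le_czNetworkWeight
  obtain ⟨M, hMN, hMc, hM⟩ := hN _ (hU.preimage hf)
  refine ⟨(f '' ·) '' M, image_mono hMN, hMc.image _, ?_⟩
  rw [sUnion_image, ← image_iUnion₂, ← sUnion_eq_biUnion, hM, image_preimage_eq U hs]

end Transfer

/-! ### Proper maps to second countable spaces; compact and Lindelöf Σ-spaces -/

section Proper

theorem mk_finset_le_of_le {α : Type u} {κ : Cardinal.{u}} (h : #α ≤ κ) (hκ : ℵ₀ ≤ κ) :
    #(Finset α) ≤ κ := by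
  cases finite_or_infinite α
  · exact (lt_aleph0_of_finite _).le.trans hκ
  · rwa [mk_finset_of_infinite]

theorem weight_le_of_subbasis {X : Type u} [t : TopologicalSpace X] {S : Set (Set X)}
    (h : t = TopologicalSpace.generateFrom S) {κ : Cardinal.{u}} (hS : #S ≤ κ) (hκ : ℵ₀ ≤ κ) :
    weight X ≤ κ := by
  refine weight_le (TopologicalSpace.isTopologicalBasis_of_subbasis h) ?_ hκ
  refine (mk_le_mk_of_subset (t := range fun T : Finset S => ⋂₀ (Subtype.val '' (T : Set S)))
    ?_).trans (mk_range_le.trans (mk_finset_le_of_le hS hκ))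
  rintro _ ⟨F, ⟨hF, hFS⟩, rfl⟩
  refine ⟨(hF.preimage (f := ((↑) : S → Set X)) Subtype.val_injective.injOn).toFinset, ?_⟩
  simp only [Finite.coe_toFinset, Subtype.image_preimage_coe, inter_eq_right.mpr hFS]

variable {X M : Type u} [TopologicalSpace X] [TopologicalSpace M]

/-- A subbase consists of one separating open set for each separable pair of network members,
together with the preimages of a countable base of M. The latter force ultrafilters to converge by
properness; the former determine the limit. -/
theorem weight_le_networkWeight_of_isProperMap [T2Space X] [SecondCountableTopology M]
    {g : X → M} (hg : IsProperMap g) : weight X ≤ networkWeight X := by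
  obtain ⟨N, hN, hle⟩ := exists_isNetwork_mk_le_networkWeight X
  have sep : ∀ p : N × N, ∃ U : Set X, IsOpen U ∧
      ((∃ U V : Set X, IsOpen U ∧ IsOpen V ∧ Disjoint U V ∧ p.1.1 ⊆ U ∧ p.2.1 ⊆ V) →
        p.1.1 ⊆ U ∧ ∃ V, IsOpen V ∧ Disjoint U V ∧ p.2.1 ⊆ V) := by
    intro p
    by_cases h : ∃ U V : Set X, IsOpen U ∧ IsOpen V ∧ Disjoint U V ∧ p.1.1 ⊆ U ∧ p.2.1 ⊆ V
    · obtain ⟨U, V, hU, hV, hd, h1, h2⟩ := h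
      exact ⟨U, hU, fun _ => ⟨h1, V, hV, hd, h2⟩⟩
    · exact ⟨∅, isOpen_empty, fun h' => absurd h' h⟩
  choose W hWo hW using sep
  let S := range W ∪ (g ⁻¹' ·) '' TopologicalSpace.countableBasis M
  have hSo : ∀ s ∈ S, IsOpen s := by
    rintro s (⟨p, rfl⟩ | ⟨b, hb, rfl⟩)
    · exact hWo p
    · exact (TopologicalSpace.isOpen_of_mem_countableBasis hb).preimage hg.continuous
  have hS : ‹TopologicalSpace X› = TopologicalSpace.generateFrom S := by
    refine (le_generateFrom hSo).antisymm (le_of_nhds_le_nhds fun x => ?_)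
    rw [Filter.le_iff_ultrafilter]
    intro F hF
    rw [TopologicalSpace.nhds_generateFrom] at hF
    have hF' : ∀ s ∈ S, x ∈ s → s ∈ F := fun s hs hx =>
      Filter.le_principal_iff.mp (hF.trans (iInf₂_le s ⟨hx, hs⟩))
    have hgF : Filter.Tendsto g F (𝓝 (g x)) := by
      rw [(TopologicalSpace.isBasis_countableBasis M).nhds_hasBasis.tendsto_right_iff]
      rintro b ⟨hb, hxb⟩
      exact hF' _ (Or.inr ⟨b, hb, rfl⟩) hxb
    -- F tends to x only in the generated topology; properness supplies a limit x' in the original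
    -- one. If x ≠ x', the chosen set W around x and an open set around x' disjoint from it both lie
    -- in F.
    obtain ⟨x', -, hx'⟩ := hg.ultrafilter_le_nhds_of_tendsto hgF
    suffices x = x' by rwa [this]
    by_contra hne
    obtain ⟨U, V, hU, hV, hxU, hxV, hd⟩ := t2_separation hne
    obtain ⟨A, hA, hxA, hAU⟩ := hN.exists_mem_subset hU hxU
    obtain ⟨B, hB, hxB, hBV⟩ := hN.exists_mem_subset hV hxV
    obtain ⟨h1, V', hV', hd', h2⟩ := hW (⟨A, hA⟩, ⟨B, hB⟩) ⟨U, V, hU, hV, hd, hAU, hBV⟩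
    have hWF := hF' _ (Or.inl ⟨(⟨A, hA⟩, ⟨B, hB⟩), rfl⟩) (h1 hxA)
    have hVF : V' ∈ F := hx' (hV'.mem_nhds (h2 hxB))
    exact F.empty_notMem (hd'.inter_eq ▸ Filter.inter_mem hWF hVF)
  have h0 : ℵ₀ ≤ networkWeight X := aleph0_le_networkWeight
  refine weight_le_of_subbasis hS ((mk_union_le _ _).trans (add_le_of_le h0 ?_ ?_)) h0
  · refine mk_range_le.trans ?_
    rw [← mul_def]
    exact mul_le_of_le h0 hle hle
  · exact (le_aleph0_iff_set_countable.mpr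
      ((TopologicalSpace.countable_countableBasis M).image _)).trans h0

theorem _root_.IsProperMap.lindelofSpace [LindelofSpace M] {g : X → M} (hg : IsProperMap g) :
    LindelofSpace X := by
  rw [← isLindelof_univ_iff]
  intro F _ _ _
  obtain ⟨y, -, hy⟩ := isLindelof_univ (X := M) (f := Filter.map g F) (by simp)
  obtain ⟨x, -, hx⟩ := hg.clusterPt_of_mapClusterPt hy
  exact ⟨x, mem_univ x, hx⟩

theorem networkWeight_subtype_prod_le [SecondCountableTopology M] (L : Set (X × M)) :
    networkWeight L ≤ networkWeight X := by
  obtain ⟨N, hN, hle⟩ := exists_isNetwork_mk_le_networkWeight X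
  have h0 : ℵ₀ ≤ networkWeight X := aleph0_le_networkWeight
  let B := TopologicalSpace.countableBasis M
  let Φ : N × B → Set L := fun p => Subtype.val ⁻¹' (p.1.1 ×ˢ p.2.1)
  refine networkWeight_le (N := range Φ) (fun U hU => ?_) ?_ h0
  · refine ⟨{s ∈ range Φ | s ⊆ U}, fun s hs => hs.1,
      Subset.antisymm (sUnion_subset fun s hs => hs.2) fun x hx => ?_⟩
    obtain ⟨V, hV, rfl⟩ := isOpen_induced_iff.mp hU
    obtain ⟨V₁, V₂, h₁, h₂, hx₁, hx₂, hV'⟩ := isOpen_prod_iff.mp hV x.1.1 x.1.2 hx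
    obtain ⟨s, hs, hxs, hsV⟩ := hN.exists_mem_subset h₁ hx₁
    obtain ⟨b, hb, hxb, hbV⟩ :=
      (TopologicalSpace.isBasis_countableBasis M).exists_subset_of_mem_open hx₂ h₂
    exact ⟨Φ (⟨s, hs⟩, ⟨b, hb⟩), ⟨⟨_, rfl⟩,
      preimage_mono ((prod_mono hsV hbV).trans hV')⟩, hxs, hxb⟩
  · refine mk_range_le.trans ?_
    rw [← mul_def]
    exact mul_le_of_le h0 hle ((le_aleph0_iff_set_countable.mpr
      (TopologicalSpace.countable_countableBasis M)).trans h0)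

/-- Y itself may have large network weight, so it is replaced by its image under (f, g) in X × M.
The projection to M stays proper on this image, and the projection to X stays onto. -/
theorem IsLindelofSigmaSpace.czNetworkWeight_le (h : IsLindelofSigmaSpace X) :
    czNetworkWeight X ≤ networkWeight X := by
  obtain ⟨_, Y, _, ⟨_, M, _, _, _, g, hg, -⟩, f, hf, hfs⟩ := h
  let φ : Y → range (fun y => (f y, g y)) := rangeFactorization _
  have hφ : Continuous φ := (hf.prodMk hg.continuous).subtype_mk _
  have hψ : IsProperMap fun p : range (fun y => (f y, g y)) => p.1.2 :=
    isProperMap_of_comp_of_surj hφ (by fun_prop) hg rangeFactorization_surjective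
  have := hψ.lindelofSpace
  have hX := lift_czNetworkWeight_le_of_surjective
    (f := fun p : range (fun y => (f y, g y)) => p.1.1) (by fun_prop)
    fun x => (hfs x).imp' φ fun y hy => hy
  rw [Cardinal.lift_le] at hX
  exact hX.trans (czNetworkWeight_le_weight.trans
    ((weight_le_networkWeight_of_isProperMap hψ).trans (networkWeight_subtype_prod_le _)))

theorem weight_le_networkWeight_of_compactSpace [CompactSpace X] [T2Space X] :
    weight X ≤ networkWeight X :=
  weight_le_networkWeight_of_isProperMap (M := PUnit)
    (continuous_const (y := PUnit.unit)).isProperMap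

end Proper

/-! ### Dense subspaces of products -/

section Box

variable {A : Type v} {Z : A → Type w}

/-- The box in a product of spaces determined by finitely many conditions `z a ∈ b a n`. -/
def box (b : ∀ a, ℕ → Set (Z a)) (s : Finset (A × ℕ)) : Set (∀ a, Z a) :=
  {z | ∀ p ∈ s, z p.1 ∈ b p.1 p.2}

variable {b : ∀ a, ℕ → Set (Z a)}

theorem _root_.Set.Countable.finset_forall_fst_mem {C : Set A} (hC : C.Countable) :
    {s : Finset (A × ℕ) | ∀ p ∈ s, p.1 ∈ C}.Countable := by
  refine ((countable_ofPred_finite_subset (hC.prod (countable_univ_iff.mpr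
    (inferInstance : Countable ℕ)))).preimage Finset.coe_injective).mono fun s hs =>
      by exact ⟨s.finite_toSet, fun p hp => ⟨hs p hp, trivial⟩⟩

theorem box_mono {s t : Finset (A × ℕ)} (h : s ⊆ t) : box b t ⊆ box b s :=
  fun _ hz p hp => hz p (h hp)

theorem lift_mk_range_preimage_box_le [Infinite A] {X : Type u} {e : X → ∀ a, Z a} :
    Cardinal.lift.{v} #(range fun s => e ⁻¹' box b s) ≤ Cardinal.lift.{u} #A := by
  refine mk_range_le_lift.trans (Cardinal.lift_le.mpr ?_)
  rw [mk_finset_of_infinite, mk_prod, mk_nat, lift_aleph0, lift_uzero]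
  exact mul_le_of_le (aleph0_le_mk A) le_rfl (aleph0_le_mk A)

variable [∀ a, TopologicalSpace (Z a)]

theorem isTopologicalBasis_range_box
    (hb : ∀ a, TopologicalSpace.IsTopologicalBasis (range (b a))) :
    TopologicalSpace.IsTopologicalBasis (range (box b)) := by
  classical
  have ho : ∀ s, IsOpen (box b s) := fun s => by
    have : box b s = ⋂ p ∈ s, (fun z : ∀ a, Z a => z p.1) ⁻¹' b p.1 p.2 := by
      ext z
      simp [box]
    rw [this]
    exact isOpen_biInter_finset fun p _ =>
      ((hb p.1).isOpen (mem_range_self p.2)).preimage (continuous_apply p.1)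
  refine TopologicalSpace.isTopologicalBasis_of_isOpen_of_nhds (by rintro _ ⟨s, rfl⟩; exact ho s)
    fun z U hz hU => ?_
  obtain ⟨I, u, hu, hIU⟩ := isOpen_pi_iff.mp hU z hz
  have : ∀ a, ∃ n, a ∈ I → z a ∈ b a n ∧ b a n ⊆ u a := fun a => by
    by_cases ha : a ∈ I
    · obtain ⟨_, ⟨n, rfl⟩, h1, h2⟩ :=
        (hb a).exists_subset_of_mem_open (hu a ha).2 (hu a ha).1
      exact ⟨n, fun _ => ⟨h1, h2⟩⟩
    · exact ⟨0, fun h => absurd h ha⟩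
  choose n hn using this
  refine ⟨_, ⟨I.image fun a => (a, n a), rfl⟩, ?_, fun y hy => hIU fun a ha => ?_⟩
  · intro p hp
    obtain ⟨a, ha, rfl⟩ := Finset.mem_image.mp hp
    exact (hn a ha).1
  · exact (hn a ha).2 (hy (a, n a) (Finset.mem_image_of_mem _ ha))

variable {X : Type u} [TopologicalSpace X] {e : X → ∀ a, Z a}

theorem isTopologicalBasis_range_preimage_box
    (hb : ∀ a, TopologicalSpace.IsTopologicalBasis (range (b a))) (he : IsEmbedding e) :
    TopologicalSpace.IsTopologicalBasis (range fun s => e ⁻¹' box b s) := by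
  have := (isTopologicalBasis_range_box hb).isInducing he.isInducing
  rwa [← range_comp] at this

/-- Closing off: the set of boxes disjoint from an open set `G` of a dense subspace is governed by
countably many coordinates. -/
theorem exists_countable_forall_disjoint_box
    (hb : ∀ a, TopologicalSpace.IsTopologicalBasis (range (b a))) (he : IsEmbedding e)
    (hd : DenseRange e) {G : Set X} (hG : IsOpen G) :
    ∃ C : Set A, C.Countable ∧ ∀ s t : Finset (A × ℕ), (∀ p, p ∈ t ↔ p ∈ s ∧ p.1 ∈ C) →
      (e ⁻¹' box b s).Nonempty → Disjoint (e ⁻¹' box b s) G → Disjoint (e ⁻¹' box b t) G := by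
  classical
  have hB := isTopologicalBasis_range_preimage_box hb he
  have hbox := isTopologicalBasis_range_box hb
  -- τ s will name a witnessing box inside G for each box that meets G; C is then closed under
  -- adding the coordinates of τ s.
  have step : ∀ s : Finset (A × ℕ), ∃ t : Finset (A × ℕ), (e ⁻¹' box b s ∩ G).Nonempty →
      (e ⁻¹' box b t).Nonempty ∧ e ⁻¹' box b t ⊆ e ⁻¹' box b s ∩ G := fun s => by
    by_cases h : (e ⁻¹' box b s ∩ G).Nonempty
    · obtain ⟨x, hx⟩ := h
      obtain ⟨_, ⟨t, rfl⟩, hxt, ht⟩ :=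
        hB.exists_subset_of_mem_open hx ((hB.isOpen (mem_range_self s)).inter hG)
      exact ⟨t, fun _ => ⟨⟨x, hxt⟩, ht⟩⟩
    · exact ⟨∅, fun h' => absurd h' h⟩
  choose τ hτ using step
  let next : Set A → Set A := fun C =>
    C ∪ ⋃ s ∈ {s : Finset (A × ℕ) | ∀ p ∈ s, p.1 ∈ C}, Prod.fst '' (τ s : Set (A × ℕ))
  let D : ℕ → Set A := fun n => next^[n] ∅
  have hDs : ∀ n, D (n + 1) = next (D n) := fun n => Function.iterate_succ_apply' _ _ _
  have hDc : ∀ n, (D n).Countable := by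
    intro n
    induction n with
    | zero => exact countable_empty
    | succ n ih =>
      rw [hDs]
      exact ih.union (ih.finset_forall_fst_mem.biUnion fun s _ => (τ s).countable_toSet.image _)
  have hDm : Monotone D := monotone_nat_of_le_succ fun n => by
    rw [hDs]
    exact subset_union_left
  refine ⟨⋃ n, D n, countable_iUnion hDc, fun s t hts ⟨x₀, hx₀⟩ hsG => ?_⟩
  by_contra hne
  have hne' := not_disjoint_iff_nonempty_inter.mp hne
  obtain ⟨⟨x, hxτ⟩, hsub⟩ := hτ t hne'
  obtain ⟨n, hn⟩ : ∃ n, ∀ p ∈ t, p.1 ∈ D n := by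
    obtain ⟨n, hn⟩ := hDm.directed_le.exists_mem_subset_of_finset_subset_biUnion
      (s := t.image Prod.fst) (by
        rintro _ ha
        obtain ⟨p, hp, rfl⟩ := Finset.mem_image.mp (Finset.mem_coe.mp ha)
        exact ((hts p).mp hp).2)
    exact ⟨n, fun p hp => hn (Finset.mem_coe.mpr (Finset.mem_image_of_mem _ hp))⟩
  have hτC : ∀ p ∈ τ t, p.1 ∈ ⋃ n, D n := fun p hp => by
    refine mem_iUnion.mpr ⟨n + 1, ?_⟩
    rw [hDs]
    exact Or.inr (mem_biUnion hn ⟨p, hp, rfl⟩)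
  -- The box of s constrains z on C only through t, which x satisfies, and off C through x₀; the box
  -- of τ t lives on C. By density the two boxes share a point of X, which lies in G, contradicting
  -- `hsG`.
  let z : ∀ a, Z a := fun a => if a ∈ ⋃ n, D n then e x a else e x₀ a
  have hz : z ∈ box b s ∩ box b (τ t) := by
    refine ⟨fun p hp => ?_, fun p hp => ?_⟩
    · by_cases hpC : p.1 ∈ ⋃ n, D n
      · have hpt : p ∈ t := (hts p).mpr ⟨hp, hpC⟩
        simpa only [z, if_pos hpC] using (hsub hxτ).1 p hpt
      · simpa only [z, if_neg hpC] using hx₀ p hp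
    · simpa only [z, if_pos (hτC p hp)] using hxτ p hp
  obtain ⟨y, hys, hyτ⟩ := hd.exists_mem_open
    ((hbox.isOpen (mem_range_self s)).inter (hbox.isOpen (mem_range_self (τ t)))) ⟨z, hz⟩
  exact disjoint_left.mp hsG hys (hsub hyτ).2

/-- A basic box missing G still misses G after its conditions outside the countable set C are
dropped, and only countably many boxes have all coordinates in C. -/
theorem exists_countable_sUnion_box_eq_compl_closure
    (hb : ∀ a, TopologicalSpace.IsTopologicalBasis (range (b a))) (he : IsEmbedding e)
    (hd : DenseRange e) {G : Set X} (hG : IsOpen G) :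
    ∃ M ⊆ range fun s => e ⁻¹' box b s, M.Countable ∧ ⋃₀ M = (closure G)ᶜ := by
  classical
  have hB := isTopologicalBasis_range_preimage_box hb he
  obtain ⟨C, hC, h⟩ := exists_countable_forall_disjoint_box hb he hd hG
  let T : Set (Finset (A × ℕ)) :=
    {t | (∀ p ∈ t, p.1 ∈ C) ∧ Disjoint (e ⁻¹' box b t) G}
  have hT : T.Countable := hC.finset_forall_fst_mem.mono fun s hs => hs.1
  refine ⟨(fun s => e ⁻¹' box b s) '' T, image_subset_range _ _, hT.image _,
    Subset.antisymm ?_ fun x hx => ?_⟩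
  · rintro x ⟨_, ⟨t, ht, rfl⟩, hxt⟩ hxG
    obtain ⟨y, hy, hyG⟩ := mem_closure_iff.mp hxG _ (hB.isOpen (mem_range_self t)) hxt
    exact disjoint_left.mp ht.2 hy hyG
  · obtain ⟨_, ⟨s, rfl⟩, hxs, hs⟩ :=
      hB.exists_subset_of_mem_open hx isClosed_closure.isOpen_compl
    have hsG : Disjoint (e ⁻¹' box b s) G :=
      disjoint_left.mpr fun y hy hyG => hs hy (subset_closure hyG)
    refine ⟨_, ⟨s.filter fun p => p.1 ∈ C, ⟨fun p hp => ?_, ?_⟩, rfl⟩,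
      box_mono (Finset.filter_subset _ _) hxs⟩
    · exact (Finset.mem_filter.mp hp).2
    · exact h s _ (by simp) ⟨x, hxs⟩ hsG

theorem isCzNetwork_range_preimage_box
    (hb : ∀ a, TopologicalSpace.IsTopologicalBasis (range (b a))) (he : IsEmbedding e)
    (hd : DenseRange e) : IsCzNetwork (range fun s => e ⁻¹' box b s) := by
  intro U hU
  obtain ⟨f, hf, -, hfU⟩ := hU.exists_continuous_nonneg
  -- The closure of {f < 1/(n+1)} lies in {f ≤ 1/(n+1)} and contains the zero set of f.
  have hUn : U = ⋃ n : ℕ, (closure {x | f x < 1 / ((n : ℝ) + 1)})ᶜ := by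
    ext x
    rw [hfU, mem_iUnion]
    refine ⟨fun hx => (exists_nat_one_div_lt hx).imp fun n hn hx' => ?_, fun ⟨n, hn⟩ => ?_⟩
    · exact hn.not_ge (closure_minimal (fun y (hy : f y < _) => hy.le)
        (isClosed_le hf continuous_const) hx')
    · by_contra hx
      exact hn (subset_closure ((not_lt.mp hx).trans_lt Nat.one_div_pos_of_nat))
  choose M hM hMc hMU using fun n : ℕ => exists_countable_sUnion_box_eq_compl_closure hb he hd
    (isOpen_lt hf (continuous_const (y := 1 / ((n : ℝ) + 1))))
  refine ⟨⋃ n, M n, iUnion_subset hM, countable_iUnion hMc, ?_⟩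
  rw [sUnion_iUnion, hUn]
  exact iUnion_congr hMU

/-- Each nonempty base member contains a nonempty trace of a box, with finitely many coordinates.
Every index occurs among these coordinates for some base member, so A is covered by finite sets
indexed by the base. -/
theorem lift_mk_le_lift_weight [Infinite A]
    (hb : ∀ a, TopologicalSpace.IsTopologicalBasis (range (b a))) [∀ a, T2Space (Z a)]
    [∀ a, Nontrivial (Z a)] (he : IsEmbedding e) (hd : DenseRange e) :
    Cardinal.lift.{u} #A ≤ Cardinal.lift.{v} (weight X) := by
  classical
  obtain ⟨B, hB, hle⟩ := exists_isTopologicalBasis_mk_le_weight X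
  have hbox := isTopologicalBasis_range_box hb
  have hXb := isTopologicalBasis_range_preimage_box hb he
  have sub : ∀ U : B, ∃ s : Finset (A × ℕ),
      U.1.Nonempty → (e ⁻¹' box b s).Nonempty ∧ e ⁻¹' box b s ⊆ U.1 := fun U => by
    by_cases h : U.1.Nonempty
    · obtain ⟨x, hx⟩ := h
      obtain ⟨_, ⟨s, rfl⟩, hxs, hs⟩ := hXb.exists_subset_of_mem_open hx (hB.isOpen U.2)
      exact ⟨s, fun _ => ⟨⟨x, hxs⟩, hs⟩⟩
    · exact ⟨∅, fun h' => absurd h' h⟩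
  choose σ hσ using sub
  have hcov : ∀ a, ∃ U : B, ∃ n, (a, n) ∈ σ U := by
    intro a
    obtain ⟨p, q, hpq⟩ := exists_pair_ne (Z a)
    obtain ⟨P, Q, hP, hQ, hpP, hqQ, hPQ⟩ := t2_separation hpq
    let z₀ : ∀ a, Z a := fun a => Classical.arbitrary (Z a)
    obtain ⟨x, hx⟩ := hd.exists_mem_open (hP.preimage (continuous_apply a))
      ⟨Function.update z₀ a p, by simpa using hpP⟩
    obtain ⟨U, hU, hxU, hUP⟩ := hB.exists_subset_of_mem_open
      (show x ∈ e ⁻¹' ((fun z : ∀ a, Z a => z a) ⁻¹' P) from hx)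
      ((hP.preimage (continuous_apply a)).preimage he.continuous)
    obtain ⟨⟨y, hy⟩, hsU⟩ := hσ ⟨U, hU⟩ ⟨x, hxU⟩
    refine ⟨⟨U, hU⟩, ?_⟩
    -- If the box did not involve a, the a-th coordinate of a point in it could be changed to q;
    -- density then gives a point of U whose a-th coordinate is in Q, although U projects into P.
    by_contra! hn
    obtain ⟨x', hx', hxQ⟩ := hd.exists_mem_open
      ((hbox.isOpen (mem_range_self (σ ⟨U, hU⟩))).inter (hQ.preimage (continuous_apply a)))
      ⟨Function.update (e y) a q, fun r hr => by
        have : r.1 ≠ a := by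
          rintro rfl
          exact hn r.2 hr
        simpa [this] using hy r hr, by simpa using hqQ⟩
    exact disjoint_left.mp hPQ (hUP (hsU hx')) hxQ
  choose U n hUn using hcov
  have hfib : ∀ V : B, Cardinal.lift.{u} #(U ⁻¹' {V}) ≤ ℵ₀ := fun V => by
    rw [lift_le_aleph0, le_aleph0_iff_set_countable]
    refine (((σ V).image Prod.fst).finite_toSet.subset fun a ha => ?_).countable
    have hV : U a = V := ha
    exact Finset.mem_coe.mpr (Finset.mem_image.mpr ⟨_, hV ▸ hUn a, rfl⟩)
  have h0 : ℵ₀ ≤ Cardinal.lift.{v} (weight X) := by simpa using aleph0_le_weight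
  exact (lift_mk_le_lift_mk_mul_of_lift_mk_preimage_le U hfib).trans
    (mul_le_of_le h0 (Cardinal.lift_le.mpr hle) h0)

theorem exists_isTopologicalBasis_range_nat (S : Type w) [TopologicalSpace S]
    [TopologicalSpace.MetrizableSpace S] [TopologicalSpace.SeparableSpace S] [Nonempty S] :
    ∃ b : ℕ → Set S, TopologicalSpace.IsTopologicalBasis (range b) := by
  let _ := TopologicalSpace.metrizableSpaceMetric S
  have := UniformSpace.secondCountable_of_separable S
  have hB := TopologicalSpace.isBasis_countableBasis S
  have hne : (TopologicalSpace.countableBasis S).Nonempty := by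
    obtain ⟨t, ht, -⟩ := hB.exists_subset_of_mem_open (mem_univ (Classical.arbitrary S)) isOpen_univ
    exact ⟨t, ht⟩
  obtain ⟨b, hb⟩ := (TopologicalSpace.countable_countableBasis S).exists_eq_range hne
  exact ⟨b, hb ▸ hB⟩

theorem weight_of_dense_in_pi [Infinite A] [∀ a, TopologicalSpace.MetrizableSpace (Z a)]
    [∀ a, TopologicalSpace.SeparableSpace (Z a)] [∀ a, Nontrivial (Z a)]
    (he : IsEmbedding e) (hd : DenseRange e) :
    czNetworkWeight X ≤ weight X ∧
      Cardinal.lift.{v} (weight X) = Cardinal.lift.{u} #A := by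
  choose b hb using fun a => exists_isTopologicalBasis_range_nat (Z a)
  have hA := lift_mk_le_lift_weight hb he hd
  refine ⟨?_, (lift_weight_le (isTopologicalBasis_range_preimage_box hb he)
    lift_mk_range_preimage_box_le (aleph0_le_mk A)).antisymm hA⟩
  rw [← Cardinal.lift_le.{v}]
  exact (lift_czNetworkWeight_le (isCzNetwork_range_preimage_box hb he hd)
    lift_mk_range_preimage_box_le (aleph0_le_mk A)).trans hA

end Box

end CzNet

theorem theoremt (X : Type u) [TopologicalSpace X] [T35Space X] :
    -- (1)
    (CzNet.networkWeight X ≤ CzNet.czNetworkWeight X ∧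
      CzNet.czNetworkWeight X ≤ 2 ^ CzNet.networkWeight X) ∧
    -- (2)
    (CompactSpace X →
      CzNet.czNetworkWeight X = CzNet.networkWeight X ∧
      CzNet.networkWeight X = CzNet.weight X) ∧
    -- (3)
    (∀ (Y : Type v) [TopologicalSpace Y] [T35Space Y] (e : X → Y),
      IsEmbedding e → CzNet.IsZEmbedded (range e) →
      Cardinal.lift.{v} (CzNet.czNetworkWeight X) ≤
        Cardinal.lift.{u} (CzNet.czNetworkWeight Y)) ∧
    -- (4)
    (∀ (Y : Type v) [TopologicalSpace Y] [T35Space Y] (f : Y → X),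
      Continuous f → Function.Surjective f →
      Cardinal.lift.{v} (CzNet.czNetworkWeight X) ≤
        Cardinal.lift.{u} (CzNet.czNetworkWeight Y)) ∧
    -- (5)
    (LindelofSpace X → CzNet.czNetworkWeight X ≤ CzNet.weight X) ∧
    -- (6)
    (CzNet.IsLindelofSigmaSpace X →
      CzNet.czNetworkWeight X = CzNet.networkWeight X) ∧
    -- (7)
    (CzNet.networkWeight X = ℵ₀ → CzNet.czNetworkWeight X = ℵ₀) ∧
    -- (8)
    (∀ (A : Type v) [Infinite A] (Z : A → Type w) [∀ a, TopologicalSpace (Z a)]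
      [∀ a, TopologicalSpace.MetrizableSpace (Z a)]
      [∀ a, TopologicalSpace.SeparableSpace (Z a)] [∀ a, Nontrivial (Z a)]
      (e : X → ∀ a, Z a), IsEmbedding e → DenseRange e →
      CzNet.czNetworkWeight X ≤ CzNet.weight X ∧
      Cardinal.lift.{v} (CzNet.weight X) = Cardinal.lift.{u} #A) := by
  refine ⟨⟨CzNet.networkWeight_le_czNetworkWeight X,
    CzNet.czNetworkWeight_le_two_power_networkWeight X⟩, fun _ => ?_,
    fun Y _ _ e he hz => CzNet.lift_czNetworkWeight_le_of_isZEmbedded he hz,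
    fun Y _ _ f hf hs => CzNet.lift_czNetworkWeight_le_of_surjective hf hs,
    fun _ => CzNet.czNetworkWeight_le_weight,
    fun h => h.czNetworkWeight_le.antisymm (CzNet.networkWeight_le_czNetworkWeight X),
    CzNet.czNetworkWeight_eq_aleph0 X,
    fun A _ Z _ _ _ _ e he hd => CzNet.weight_of_dense_in_pi he hd⟩
  have h : CzNet.networkWeight X = CzNet.weight X :=
    (CzNet.networkWeight_le_weight X).antisymm CzNet.weight_le_networkWeight_of_compactSpace
  exact ⟨(CzNet.czNetworkWeight_le_weight.trans_eq h.symm).antisymm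
    (CzNet.networkWeight_le_czNetworkWeight X), h⟩
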